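/- Let $G$ be a countable, extremally disconnected, Hausdorff Boolean topological group; that is, $G$ is a countable Hausdorff topological group in which every element satisfies $x+x=0$ and in which the closure of every open set is open. Suppose that there is a family $(H_i)_{i\in I}$ of open subgroups of $G$ whose intersection $\bigcap_{i\in I}H_i$ has empty interior in $G$. Then there exists a rapid ultrafilter on $\omega$, that is, an ultrafilter $\mathcal U$ on $\omega$ such that for every function $f\colon\omega\to\omega$ there is an infinite set $A\in\mathcal U$ whose increasing enumeration $m_0<m_1<m_2<\cdots$ satisfies $m_i>f(i)$ for all $i\in\omega$. -/

import Mathlib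

/-- An ultrafilter `U` on `ω` is rapid if every function `f : ω → ω` is majorized by the increasing
enumeration `m` of some element of `U`. A strictly increasing `m : ℕ → ℕ` is exactly the increasing
enumeration of its range, and majorization is `f i < m i` for all `i`; in particular, a rapid
ultrafilter is nonprincipal. -/
def Ultrafilter.IsRapid (U : Ultrafilter ℕ) : Prop :=
  ∀ f : ℕ → ℕ, ∃ m : ℕ → ℕ, StrictMono m ∧ Set.range m ∈ U ∧ ∀ i, f i < m i

/-!
The group is a vector space over `ZMod 2`, and the hypothesis on open subgroups is used only
through characters. Countability of `G` lets one choose locally constant linear functionals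
`c 0, c 1, …` to `ZMod 2` such that every `x` has finite *support* `{k | c k x ≠ 0}` and the
vectors of empty support lie in the intersection of the given open subgroups
(`exists_characters`). As that intersection has empty interior, every neighbourhood of `0` contains
vectors of nonempty support, and their first coordinate can be pushed arbitrarily far.

Given `b 0 < b 1 < …`, a *block vector* is one whose nonempty support lies in a single interval
`[b n, b (n + 1))`. There are two cases.

* For some `b`, the point `0` is a limit of block vectors (`exists_isRapid_of_blockVectors`).
  The sum of two vectors from blocks `i < j` has `i` and `j` as its first two nonzero blocks. The
  sets of vectors with given first two nonzero blocks are open and pairwise disjoint, so for any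
  `2`-colouring of the pairs `i < j`, extremal disconnectedness provides a neighbourhood of `0`
  avoiding one of the two colours. Hence a limit ultrafilter of the block vectors is mapped by
  the block index to a Ramsey ultrafilter; only colourings comparing `j` with `f (i + 1)` are needed
  to see that it is rapid.
* For every `b`, some neighbourhood of `0` contains no block vector
  (`exists_isRapid_of_no_blockVectors`). Two vectors with equal coordinates below `s` and different
  last coordinates below `t` have a sum supported in `[s, t)`. By the pigeonhole principle, in a
  small neighbourhood of `0` there are at most `2 ^ s` possible last coordinates below `t`. For a
  rapidly growing sequence of such pairs `(s, t)` this makes the ultrafilter of last coordinates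
  rapid.
-/

open Filter Topology Set

/-! ### Rapid ultrafilters -/

/-- It suffices to find infinite members of `U` whose enumerations majorize monotone functions. -/
lemma Ultrafilter.isRapid_of_monotone {U : Ultrafilter ℕ}
    (h : ∀ f : ℕ → ℕ, Monotone f → ∃ S ∈ U, S.Infinite ∧
      ∀ m : ℕ → ℕ, StrictMono m → range m = S → ∀ i, f i < m i) : U.IsRapid := by
  intro f
  obtain ⟨S, hSU, hS, hm⟩ := h (fun n => ∑ j ∈ Finset.range (n + 1), f j) (fun a b hab =>
    Finset.sum_le_sum_of_subset (Finset.range_mono (by omega)))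
  have hr : range (Nat.nth (· ∈ S)) = S := Nat.range_nth_of_infinite hS
  refine ⟨Nat.nth (· ∈ S), Nat.nth_strictMono hS, by rwa [hr], fun i => ?_⟩
  exact lt_of_le_of_lt (Finset.single_le_sum (fun _ _ => Nat.zero_le _)
    (Finset.self_mem_range_succ i)) (hm _ (Nat.nth_strictMono hS) hr i)

/-! ### Characters with finite supports -/

section Characters

variable {G : Type*} [AddCommGroup G] [Module (ZMod 2) G]

/-- A finite-dimensional subspace over `ZMod 2` is finite, so only finitely many of the `H i` are
needed to separate `x` from it. -/
lemma exists_finite_notMem_span_sup {ι : Type*} (H : ι → Submodule (ZMod 2) G) {s : Set G}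
    (hs : s.Finite) {x : G} (hx : x ∉ Submodule.span (ZMod 2) s ⊔ ⨅ i, H i) :
    ∃ t : Set ι, t.Finite ∧ x ∉ Submodule.span (ZMod 2) s ⊔ ⨅ i ∈ t, H i := by
  have : FiniteDimensional (ZMod 2) (Submodule.span (ZMod 2) s) :=
    FiniteDimensional.span_of_finite _ hs
  have : Finite (Submodule.span (ZMod 2) s) := Module.finite_of_finite (ZMod 2)
  have key : ∀ w : Submodule.span (ZMod 2) s, ∃ i, x - w ∉ H i := by
    intro w
    by_contra! hw
    refine hx (Submodule.mem_sup.2 ⟨w, w.2, x - w, ?_, by abel⟩)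
    simpa using hw
  choose i hi using key
  refine ⟨range i, finite_range i, fun hmem => ?_⟩
  obtain ⟨w, hw, z, hz, rfl⟩ := Submodule.mem_sup.1 hmem
  simp only [Submodule.mem_iInf] at hz
  exact hi ⟨w, hw⟩ (by simpa using hz _ (mem_range_self ⟨w, hw⟩))

variable [TopologicalSpace G] [IsTopologicalAddGroup G]

lemma LinearMap.isLocallyConstant_of_isOpen_of_le_ker {K : Submodule (ZMod 2) G}
    (hK : IsOpen (K : Set G)) {c : G →ₗ[ZMod 2] ZMod 2} (hc : K ≤ LinearMap.ker c) :
    IsLocallyConstant c := by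
  refine (IsLocallyConstant.iff_exists_open _).2 fun x =>
    ⟨(fun y => y - x) ⁻¹' K, hK.preimage (by fun_prop), by simp, fun y hy => ?_⟩
  have : c (y - x) = 0 := hc hy
  rwa [map_sub, sub_eq_zero] at this

/-- The functional `c k` is chosen to kill the first `k` elements of an enumeration of `G` and,
if possible, not the `k`-th one. The first property makes the supports finite, the second makes
the functionals separate points modulo the intersection. -/
lemma exists_characters [Countable G] {ι : Type*} (H : ι → Submodule (ZMod 2) G)
    (hH : ∀ i, IsOpen (H i : Set G)) :
    ∃ c : ℕ → G →ₗ[ZMod 2] ZMod 2, (∀ k, IsLocallyConstant (c k)) ∧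
      (∀ x, ∃ n, ∀ k, n < k → c k x = 0) ∧ ∀ x, (∀ k, c k x = 0) → x ∈ ⨅ i, H i := by
  obtain ⟨g, hg⟩ := exists_surjective_nat G
  let V : ℕ → Submodule (ZMod 2) G := fun k => Submodule.span (ZMod 2) (g '' Iio k)
  have key : ∀ k, ∃ c : G →ₗ[ZMod 2] ZMod 2, IsLocallyConstant c ∧
      V k ⊔ (⨅ i, H i) ≤ LinearMap.ker c ∧ (g k ∉ V k ⊔ ⨅ i, H i → c (g k) ≠ 0) := by
    intro k
    by_cases hk : g k ∈ V k ⊔ ⨅ i, H i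
    · exact ⟨0, IsLocallyConstant.const 0, by simp, fun h => absurd hk h⟩
    obtain ⟨t, ht, hkt⟩ := exists_finite_notMem_span_sup H ((finite_Iio k).image g) hk
    obtain ⟨c, hc, hle⟩ := Submodule.exists_le_ker_of_notMem hkt
    refine ⟨c, LinearMap.isLocallyConstant_of_isOpen_of_le_ker (K := ⨅ i ∈ t, H i) ?_
      (le_sup_right.trans hle), le_trans (sup_le_sup_left ?_ _) hle, fun _ => hc⟩
    · simp only [Submodule.coe_iInf]
      exact ht.isOpen_biInter fun i _ => hH i
    · exact le_iInf₂ fun i _ => iInf_le H i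
  choose c hc hle hne using key
  refine ⟨c, hc, fun x => ?_, ?_⟩
  · obtain ⟨j, rfl⟩ := hg x
    exact ⟨j, fun k hk => hle k (Submodule.mem_sup_left
      (Submodule.subset_span (mem_image_of_mem g hk)))⟩
  · have main : ∀ k, ∀ x ∈ V k, (∀ j, c j x = 0) → x ∈ ⨅ i, H i := by
      intro k
      induction k with
      | zero =>
        intro x hx _
        have : x = 0 := by simpa [V] using hx
        exact this ▸ zero_mem _
      | succ k ih =>
        -- A vector of `V k ⊔ ⨅ i, H i` killed by all `c j` reduces to the inductive hypothesis.
        have ih' : ∀ x ∈ V k ⊔ ⨅ i, H i, (∀ j, c j x = 0) → x ∈ ⨅ i, H i := by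
          intro x hx h0
          obtain ⟨y, hy, z, hz, rfl⟩ := Submodule.mem_sup.1 hx
          refine add_mem (ih y hy fun j => ?_) hz
          have hz0 : c j z = 0 := hle j (Submodule.mem_sup_right hz)
          simpa [hz0] using h0 j
        intro x hx h0
        have hV : V (k + 1) = Submodule.span (ZMod 2) (insert (g k) (g '' Iio k)) := by
          simp only [V]
          rw [← image_insert_eq]
          congr 2
          ext j
          simp only [mem_Iio, mem_insert_iff]
          omega
        rw [hV] at hx
        obtain ⟨a, y, hy, rfl⟩ := Submodule.mem_span_insert.1 hx
        apply ih' _ _ h0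
        have hy0 : c k y = 0 := hle k (Submodule.mem_sup_left hy)
        have hak : a * c k (g k) = 0 := by simpa [hy0] using h0 k
        refine add_mem ?_ (Submodule.mem_sup_left hy)
        rcases mul_eq_zero.1 hak with ha | hgk
        · simp [ha]
        · exact Submodule.smul_mem _ _ (by_contra fun h => hne k h hgk)
    intro x hx
    obtain ⟨j, rfl⟩ := hg x
    exact main (j + 1) _ (Submodule.subset_span (mem_image_of_mem g (by simp))) hx

end Characters

/-! ### Block vectors -/

section Blocks

variable {G : Type*} [AddCommGroup G] [Module (ZMod 2) G]

/-- A vector whose support with respect to the functionals `c` is nonempty and contained in the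
interval `[b n, b (n + 1))`. -/
def IsBlockVector (c : ℕ → G →ₗ[ZMod 2] ZMod 2) (b : ℕ → ℕ) (n : ℕ) (x : G) : Prop :=
  (∃ k, c k x ≠ 0) ∧ ∀ k, c k x ≠ 0 → b n ≤ k ∧ k < b (n + 1)

/-- The vectors whose first two nonzero blocks, with respect to the block decomposition of the
coordinates defined by `b`, are the blocks `i` and `j`, where `i < j`. -/
def firstTwoBlocks (c : ℕ → G →ₗ[ZMod 2] ZMod 2) (b : ℕ → ℕ) (i j : ℕ) : Set G :=
  {x | (∀ k, k < b j → ¬(b i ≤ k ∧ k < b (i + 1)) → c k x = 0) ∧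
    (∃ k, b i ≤ k ∧ k < b (i + 1) ∧ c k x ≠ 0) ∧ ∃ k, b j ≤ k ∧ k < b (j + 1) ∧ c k x ≠ 0}

variable {c : ℕ → G →ₗ[ZMod 2] ZMod 2} {b : ℕ → ℕ}

lemma StrictMono.block_index_unique (hb : StrictMono b) {m n k : ℕ} (hm : b m ≤ k ∧ k < b (m + 1))
    (hn : b n ≤ k ∧ k < b (n + 1)) : m = n := by
  have h1 := hb.lt_iff_lt.1 (hm.1.trans_lt hn.2)
  have h2 := hb.lt_iff_lt.1 (hn.1.trans_lt hm.2)
  omega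

lemma IsBlockVector.index_unique (hb : StrictMono b) {m n : ℕ} {x : G}
    (hm : IsBlockVector c b m x) (hn : IsBlockVector c b n x) : m = n := by
  obtain ⟨k, hk⟩ := hm.1
  exact hb.block_index_unique (hm.2 k hk) (hn.2 k hk)

lemma IsBlockVector.add_mem_firstTwoBlocks (hb : StrictMono b) {i j : ℕ} {x y : G}
    (hx : IsBlockVector c b i x) (hy : IsBlockVector c b j y) (hij : i < j) :
    x + y ∈ firstTwoBlocks c b i j := by
  have hxz : ∀ k, ¬(b i ≤ k ∧ k < b (i + 1)) → c k x = 0 := fun k hk =>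
    by_contra fun h => hk (hx.2 k h)
  have hyz : ∀ k, ¬(b j ≤ k ∧ k < b (j + 1)) → c k y = 0 := fun k hk =>
    by_contra fun h => hk (hy.2 k h)
  obtain ⟨p, hp⟩ := hx.1
  obtain ⟨q, hq⟩ := hy.1
  have hp' := hx.2 p hp
  have hq' := hy.2 q hq
  refine ⟨fun k hk hki => ?_, ⟨p, hp'.1, hp'.2, ?_⟩, q, hq'.1, hq'.2, ?_⟩
  · rw [map_add, hxz k hki, hyz k (by omega), add_zero]
  · rwa [map_add, hyz p fun h => hij.ne (hb.block_index_unique hp' h), add_zero]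
  · rwa [map_add, hxz q fun h => hij.ne (hb.block_index_unique h hq'), zero_add]

lemma firstTwoBlocks_index_unique (hb : StrictMono b) {i j i' j' : ℕ} (hij : i < j)
    (hij' : i' < j') {x : G} (hx : x ∈ firstTwoBlocks c b i j)
    (hx' : x ∈ firstTwoBlocks c b i' j') : i = i' ∧ j = j' := by
  have first : ∀ {i j i' j' : ℕ}, i' < j' → x ∈ firstTwoBlocks c b i j →
      x ∈ firstTwoBlocks c b i' j' → ¬ i < i' := by
    rintro i j i' j' hij' ⟨-, ⟨k, hk1, hk2, hk⟩, -⟩ ⟨h, -, -⟩ hlt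
    have h1 := hb.monotone (show i + 1 ≤ i' by omega)
    have h2 := hb hij'
    exact hk (h k (by omega) (by omega))
  have hi : i = i' := le_antisymm (not_lt.1 (first hij hx' hx)) (not_lt.1 (first hij' hx hx'))
  subst hi
  have second : ∀ {j j' : ℕ}, i < j → x ∈ firstTwoBlocks c b i j →
      x ∈ firstTwoBlocks c b i j' → ¬ j < j' := by
    rintro j j' hij ⟨-, -, k, hk1, hk2, hk⟩ ⟨h, -, -⟩ hlt
    have h1 := hb.monotone (show j + 1 ≤ j' by omega)
    have h2 := hb.monotone (show i + 1 ≤ j by omega)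
    exact hk (h k (by omega) (by omega))
  exact ⟨rfl, le_antisymm (not_lt.1 (second hij' hx' hx)) (not_lt.1 (second hij hx hx'))⟩

/-- More than `2 ^ s` vectors with different last coordinates below `t` yield a sum with nonempty
support in `[s, t)`. -/
lemma exists_supported_add {W : Set G} {s t n : ℕ} (hn : 2 ^ s < n) {x : Fin n → G}
    {m : Fin n → ℕ} (hm : StrictMono m) (hmt : ∀ j, m j < t) (hx : ∀ j, x j ∈ W)
    (hne : ∀ j, c (m j) (x j) ≠ 0) (hzero : ∀ j k, m j < k → c k (x j) = 0) :
    ∃ y ∈ W, ∃ z ∈ W, (∃ k, c k (y + z) ≠ 0) ∧ ∀ k, c k (y + z) ≠ 0 → s ≤ k ∧ k < t := by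
  obtain ⟨i, j, hij, heq⟩ := Fintype.exists_ne_map_eq_of_card_lt
    (fun (j : Fin n) (k : Fin s) => c k (x j)) (by simpa using hn)
  wlog hlt : i < j generalizing i j
  · exact this j i hij.symm heq.symm (lt_of_le_of_ne (not_lt.1 hlt) hij.symm)
  refine ⟨x i, hx i, x j, hx j, ⟨m j, ?_⟩, fun k hk => ⟨?_, ?_⟩⟩
  · rw [map_add, hzero i _ (hm hlt), zero_add]
    exact hne j
  · by_contra! hks
    refine hk ?_
    rw [map_add, congrFun heq ⟨k, hks⟩, ZModModule.add_self]
  · by_contra! hkt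
    refine hk ?_
    rw [map_add, hzero i k ((hmt i).trans_le hkt), hzero j k ((hmt j).trans_le hkt), add_zero]

variable [TopologicalSpace G]

lemma isOpen_firstTwoBlocks (hc : ∀ k, IsLocallyConstant (c k)) (i j : ℕ) :
    IsOpen (firstTwoBlocks c b i j) := by
  have hex : ∀ i, IsOpen {x | ∃ k, b i ≤ k ∧ k < b (i + 1) ∧ c k x ≠ 0} := by
    intro i
    have : {x | ∃ k, b i ≤ k ∧ k < b (i + 1) ∧ c k x ≠ 0} =
        ⋃ (k) (_ : b i ≤ k) (_ : k < b (i + 1)), {x | c k x ≠ 0} := by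
      ext x
      simp only [mem_ofPred_eq, mem_iUnion, exists_prop]
    rw [this]
    exact isOpen_iUnion fun k => isOpen_iUnion fun _ => isOpen_iUnion fun _ => hc k {a | a ≠ 0}
  have hzero : IsOpen {x | ∀ k, k < b j → ¬(b i ≤ k ∧ k < b (i + 1)) → c k x = 0} := by
    have : {x | ∀ k, k < b j → ¬(b i ≤ k ∧ k < b (i + 1)) → c k x = 0} =
        ⋂ k ∈ Iio (b j), {x | ¬(b i ≤ k ∧ k < b (i + 1)) → c k x = 0} := by
      ext x
      simp
    rw [this]
    exact (finite_Iio _).isOpen_biInter fun k _ =>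
      hc k {a | ¬(b i ≤ k ∧ k < b (i + 1)) → a = 0}
  exact hzero.inter ((hex i).inter (hex j))

lemma eventually_coordinates_eq_zero (hc : ∀ k, IsLocallyConstant (c k)) (n : ℕ) :
    ∀ᶠ x in 𝓝 (0 : G), ∀ k < n, c k x = 0 := by
  have : ∀ᶠ x in 𝓝 (0 : G), ∀ k ∈ Iio n, c k x = 0 :=
    (eventually_all_finite (finite_Iio n)).2 fun k _ =>
      ((hc k).isOpen_fiber 0).mem_nhds (map_zero (c k))
  exact this

variable [IsTopologicalAddGroup G]

/-- Extremal disconnectedness makes every colouring of pairs of blocks homogeneous near `0`. -/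
lemma exists_nhds_homogeneous [ExtremallyDisconnected G] (hc : ∀ k, IsLocallyConstant (c k))
    (hb : StrictMono b) (R : ℕ → ℕ → Prop) :
    ∃ V ∈ 𝓝 (0 : G), ∃ P : Prop, ∀ i j, i < j → ∀ x ∈ V, ∀ y ∈ V, IsBlockVector c b i x →
      IsBlockVector c b j y → (R i j ↔ P) := by
  let O : Prop → Set G := fun P => ⋃ (i) (j) (_ : i < j ∧ (R i j ↔ P)), firstTwoBlocks c b i j
  have hO : ∀ P, IsOpen (O P) := fun P =>
    isOpen_iUnion fun i => isOpen_iUnion fun j => isOpen_iUnion fun _ =>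
      isOpen_firstTwoBlocks hc i j
  have hdisj : Disjoint (O True) (O False) := by
    rw [Set.disjoint_left]
    intro x hx hx'
    simp only [O, mem_iUnion] at hx hx'
    obtain ⟨i, j, ⟨hij, hR⟩, hx⟩ := hx
    obtain ⟨i', j', ⟨hij', hR'⟩, hx'⟩ := hx'
    obtain ⟨rfl, rfl⟩ := firstTwoBlocks_index_unique hb hij hij' hx hx'
    exact (hR.symm.trans hR').1 trivial
  have hcl := ExtremallyDisconnected.disjoint_closure_of_disjoint_isOpen hdisj (hO _) (hO _)
  -- `O ¬P` collects the pairs whose colour is not `P`.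
  have hP : ∃ P : Prop, (0 : G) ∉ closure (O ¬P) := by
    by_cases h : (0 : G) ∈ closure (O True)
    · exact ⟨True, by simpa using Set.disjoint_left.1 hcl h⟩
    · exact ⟨False, by simpa using h⟩
  obtain ⟨P, hP⟩ := hP
  obtain ⟨V, hV, hVP⟩ := exists_nhds_zero_half (isClosed_closure.isOpen_compl.mem_nhds hP)
  refine ⟨V, hV, P, fun i j hij x hx y hy hxi hyj => ?_⟩
  by_contra hne
  refine hVP x hx y hy (subset_closure ?_)
  simp only [O, mem_iUnion]
  exact ⟨i, j, ⟨hij, by tauto⟩, hxi.add_mem_firstTwoBlocks hb hyj hij⟩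

lemma exists_isRapid_of_blockVectors [ExtremallyDisconnected G]
    (hc : ∀ k, IsLocallyConstant (c k)) (hb : StrictMono b)
    (hlim : ∃ᶠ x in 𝓝 (0 : G), ∃ n, IsBlockVector c b n x) :
    ∃ U : Ultrafilter ℕ, U.IsRapid := by
  have hidx : ∀ x : G, ∃ n, ∀ m, IsBlockVector c b m x → m = n := by
    intro x
    by_cases h : ∃ n, IsBlockVector c b n x
    · obtain ⟨n, hn⟩ := h
      exact ⟨n, fun m hm => hm.index_unique hb hn⟩
    · exact ⟨0, fun m hm => absurd ⟨m, hm⟩ h⟩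
  choose idx hidx using hidx
  have hne : (𝓝 (0 : G) ⊓ 𝓟 {x | ∃ n, IsBlockVector c b n x}).NeBot :=
    frequently_mem_iff_neBot.1 hlim
  refine ⟨(Ultrafilter.of (𝓝 (0 : G) ⊓ 𝓟 {x | ∃ n, IsBlockVector c b n x})).map idx,
    Ultrafilter.isRapid_of_monotone fun f hf => ?_⟩
  have htail : ∀ W ∈ 𝓝 (0 : G), ∀ n, ∃ x ∈ W, ∃ m, n ≤ m ∧ IsBlockVector c b m x := by
    intro W hW n
    obtain ⟨x, ⟨m, hm⟩, hxW, hx0⟩ :=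
      (hlim.and_eventually ((eventually_mem_set.2 hW).and
        (eventually_coordinates_eq_zero hc (b n)))).exists
    refine ⟨x, hxW, m, ?_, hm⟩
    obtain ⟨k, hk⟩ := hm.1
    by_contra! hmn
    exact hk (hx0 k ((hm.2 k hk).2.trans_le (hb.monotone hmn)))
  obtain ⟨V, hV, P, hP⟩ := exists_nhds_homogeneous hc hb fun i j => f (i + 1) < j
  -- Comparing with `f (i + 1)` is enough: an enumeration satisfies `i ≤ m i`, so
  -- `f (m i + 1) < m (i + 1)` implies `f (i + 1) < m (i + 1)`. The colour `j ≤ f (i + 1)` cannot prevail, since `j` is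
  -- unbounded for fixed `i`.
  have hPtrue : P := by
    obtain ⟨x, hxV, i, -, hx⟩ := htail V hV 0
    obtain ⟨y, hyV, j, hj, hy⟩ := htail V hV (i + f (i + 1) + 1)
    exact (hP i j (by omega) x hxV y hyV hx hy).1 (by omega)
  let W : Set G := V ∩ {x | ∀ k < b (f 0 + 1), c k x = 0}
  have hW : W ∈ 𝓝 (0 : G) := inter_mem hV (eventually_coordinates_eq_zero hc _)
  refine ⟨{n | ∃ x ∈ W, IsBlockVector c b n x}, ?_, ?_, ?_⟩
  · rw [Ultrafilter.mem_map]
    refine Ultrafilter.of_le _ (mem_of_superset (inter_mem_inf hW (mem_principal_self _)) ?_)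
    rintro x ⟨hxW, n, hn⟩
    exact ⟨x, hxW, hidx x n hn ▸ hn⟩
  · refine infinite_of_not_bddAbove fun ⟨n, hn⟩ => ?_
    obtain ⟨x, hxW, m, hm, hx⟩ := htail W hW (n + 1)
    have := hn ⟨x, hxW, hx⟩
    omega
  · intro m hm hrange i
    have hmem : ∀ i, ∃ x ∈ W, IsBlockVector c b (m i) x := fun i => by
      have : m i ∈ range m := mem_range_self i
      rwa [hrange] at this
    cases i with
    | zero =>
      obtain ⟨x, hx, hxm⟩ := hmem 0
      obtain ⟨k, hk⟩ := hxm.1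
      by_contra! hle
      exact hk (hx.2 k ((hxm.2 k hk).2.trans_le (hb.monotone (by omega))))
    | succ i =>
      obtain ⟨x, hx, hxm⟩ := hmem i
      obtain ⟨y, hy, hym⟩ := hmem (i + 1)
      have h := (hP _ _ (hm i.lt_succ_self) x hx.1 y hy.1 hxm hym).2 hPtrue
      exact (hf (by have := hm.id_le i; simp only [id] at this; omega)).trans_lt h

/-! ### Last coordinates -/

lemma exists_isRapid_of_no_blockVectors (hc : ∀ k, IsLocallyConstant (c k))
    (hfin : ∀ x, ∃ n, ∀ k, n < k → c k x = 0) (hlim : ∃ᶠ x in 𝓝 (0 : G), ∃ k, c k x ≠ 0)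
    (hno : ∀ b : ℕ → ℕ, StrictMono b → ∀ᶠ x in 𝓝 (0 : G), ∀ n, ¬ IsBlockVector c b n x) :
    ∃ U : Ultrafilter ℕ, U.IsRapid := by
  have hlast : ∀ x : G, ∃ n, (∃ k, c k x ≠ 0) → c n x ≠ 0 ∧ ∀ k, n < k → c k x = 0 := by
    intro x
    by_cases h : ∃ k, c k x ≠ 0
    · obtain ⟨N, hN⟩ := hfin x
      obtain ⟨k, hk⟩ := h
      have hkN : k ≤ N := not_lt.1 fun h => hk (hN k h)
      refine ⟨Nat.findGreatest (fun k => c k x ≠ 0) N, fun _ =>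
        ⟨Nat.findGreatest_spec (P := fun k => c k x ≠ 0) hkN hk, fun l hl => ?_⟩⟩
      by_cases hlN : l ≤ N
      · exact not_not.1 (Nat.findGreatest_is_greatest hl hlN)
      · exact hN l (not_le.1 hlN)
    · exact ⟨0, fun h' => absurd h' h⟩
  choose last hlast using hlast
  have hne : (𝓝 (0 : G) ⊓ 𝓟 {x | ∃ k, c k x ≠ 0}).NeBot := frequently_mem_iff_neBot.1 hlim
  refine ⟨(Ultrafilter.of (𝓝 (0 : G) ⊓ 𝓟 {x | ∃ k, c k x ≠ 0})).map last,
    Ultrafilter.isRapid_of_monotone fun f hf => ?_⟩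
  -- The growth of `t` ensures `f i < t (n + 2)` for `i < 2 ^ t (n + 1)`, while for `i ≥ 2 ^ t n`
  -- the pigeonhole bound allows at most `i` last coordinates below `t (n + 2)`.
  let t : ℕ → ℕ := fun n => Nat.rec 0 (fun _ s => s + f (2 ^ s) + 1) n
  have ht : ∀ n, t (n + 1) = t n + f (2 ^ t n) + 1 := fun n => rfl
  have htm : StrictMono t := strictMono_nat_of_lt_succ fun n => by rw [ht]; omega
  -- The intervals `[t n, t (n + 2))` overlap, so those with even and odd `n` are treated as
  -- separate block decompositions.
  have hblocks : ∀ᶠ x in 𝓝 (0 : G), ∀ n,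
      ¬((∃ k, c k x ≠ 0) ∧ ∀ k, c k x ≠ 0 → t n ≤ k ∧ k < t (n + 2)) := by
    filter_upwards [hno (fun n => t (2 * n)) (fun a b h => htm (by omega : 2 * a < 2 * b)),
      hno (fun n => t (2 * n + 1)) (fun a b h => htm (by omega : 2 * a + 1 < 2 * b + 1))]
      with x hx hx' n hn
    obtain ⟨a, rfl | rfl⟩ := n.even_or_odd'
    · exact hx a hn
    · exact hx' a hn
  obtain ⟨V, hV, hVV⟩ := exists_nhds_zero_half hblocks
  let W : Set G := V ∩ {x | ∀ k < f 0 + 1, c k x = 0}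
  have hW : W ∈ 𝓝 (0 : G) := inter_mem hV (eventually_coordinates_eq_zero hc _)
  refine ⟨last '' (W ∩ {x | ∃ k, c k x ≠ 0}), ?_, ?_, ?_⟩
  · rw [Ultrafilter.mem_map]
    exact mem_of_superset (Ultrafilter.of_le _ (inter_mem_inf hW (mem_principal_self _)))
      (subset_preimage_image _ _)
  · refine infinite_of_not_bddAbove fun ⟨n, hn⟩ => ?_
    obtain ⟨x, hx, hxW, hx0⟩ :=
      (hlim.and_eventually ((eventually_mem_set.2 hW).and
        (eventually_coordinates_eq_zero hc (n + 1)))).exists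
    have h1 := hn (mem_image_of_mem last ⟨hxW, hx⟩)
    exact (hlast x hx).1 (hx0 _ (by omega))
  · intro m hm hrange
    have hmem : ∀ i, ∃ x ∈ W, c (m i) x ≠ 0 ∧ ∀ k, m i < k → c k x = 0 := by
      intro i
      have : m i ∈ range m := mem_range_self i
      rw [hrange] at this
      obtain ⟨x, hx, hxm⟩ := this
      exact ⟨x, hx.1, hxm ▸ hlast x hx.2⟩
    choose x hxW hxne hxzero using hmem
    have main : ∀ n i, i < 2 ^ t n → f i < m i := by
      intro n
      induction n with
      | zero =>
        intro i hi
        -- As `t 0 = 0`, only `i = 0` occurs here.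
        have hi0 : i = 0 := by
          have : t 0 = 0 := rfl
          rw [this] at hi
          omega
        subst hi0
        by_contra! hle
        exact hxne 0 ((hxW 0).2 _ (by omega))
      | succ n ih =>
        intro i hi
        rcases lt_or_ge i (2 ^ t n) with hlt | hge
        · exact ih i hlt
        by_contra! hle
        have hfi : f i < t (n + 2) := by
          have := hf hi.le
          have : t (n + 2) = t (n + 1) + f (2 ^ t (n + 1)) + 1 := ht (n + 1)
          omega
        obtain ⟨y, hy, z, hz, hyz⟩ := exists_supported_add (c := c) (W := W) (s := t n)
          (t := t (n + 2)) (n := i + 1) (by omega) (x := fun j => x j) (m := fun j => m j)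
          (fun a b hab => hm hab)
          (fun j => ((hm.monotone (Nat.lt_succ_iff.1 j.2)).trans hle).trans_lt hfi)
          (fun j => hxW j) (fun j => hxne j) (fun j => hxzero j)
        exact hVV y hy.1 z hz.1 n hyz
    intro i
    exact main i i (Nat.lt_two_pow_self.trans_le (Nat.pow_le_pow_right two_pos (htm.id_le i)))

end Blocks

/-! ### Countable extremally disconnected Boolean groups -/

theorem mainTheorem1 {G : Type*} [AddGroup G] [TopologicalSpace G] [IsTopologicalAddGroup G]
    [T2Space G] [Countable G] [ExtremallyDisconnected G]
    (hBoolean : ∀ x : G, x + x = 0)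
    {ι : Type*} (H : ι → AddSubgroup G) (hOpen : ∀ i, IsOpen (H i : Set G))
    (hInterior : interior (⋂ i, (H i : Set G)) = ∅) :
    ∃ U : Ultrafilter ℕ, U.IsRapid := by
  have hneg : ∀ x : G, -x = x := fun x => neg_eq_of_add_eq_zero_left (hBoolean x)
  let : AddCommGroup G :=
    { ‹AddGroup G› with
      add_comm := fun x y => by rw [← hneg (x + y), neg_add_rev, hneg, hneg] }
  let : Module (ZMod 2) G := AddCommGroup.zmodModule fun x => by rw [two_nsmul, hBoolean]
  obtain ⟨c, hc, hfin, hker⟩ :=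
    exists_characters (fun i => AddSubgroup.toZModSubmodule 2 (H i)) hOpen
  have hlim : ∃ᶠ x in 𝓝 (0 : G), ∃ k, c k x ≠ 0 := by
    intro h
    have h0 : (0 : G) ∈ interior (⋂ i, (H i : Set G)) := by
      refine mem_interior_iff_mem_nhds.2 (mem_of_superset h fun x hx => ?_)
      have := hker x (by simpa using hx)
      simpa using this
    simp [hInterior] at h0
  by_cases hb : ∃ b : ℕ → ℕ, StrictMono b ∧ ∃ᶠ x in 𝓝 (0 : G), ∃ n, IsBlockVector c b n x
  · obtain ⟨b, hb, h⟩ := hb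
    exact exists_isRapid_of_blockVectors hc hb h
  · refine exists_isRapid_of_no_blockVectors hc hfin hlim fun b hb' => ?_
    by_contra h
    refine hb ⟨b, hb', fun h' => h ?_⟩
    filter_upwards [h'] with x hx n hn using hx ⟨n, hn⟩
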